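/- Let $d \ge 1$, $\mathbf{c} = (c_1,\dots,c_d) \in \mathbb{C}^d$ and $\mathbf{r} = (r_1,\dots,r_d)$ with $r_i > 0$ for all $i$, and let $D = \{ \mathbf{z} \in \mathbb{C}^d : |z_i - c_i| < r_i,\ i = 1,\dots,d \}$ be the open polydisc with centre $\mathbf{c}$ and polyradius $\mathbf{r}$. Write $|\mathbf{x}| = \max_i |x_i|$ for the $\ell_\infty$ norm. Let $f : \overline{D} \to \mathbb{C}^d$ be continuous on the closure $\overline{D}$ and holomorphic in $D$, and suppose that the closure of $f(D)$ is contained in $D$. Then $f$ has exactly one fixed point $\mathbf{w}$ in $D$. Moreover, there is a number $\mu$ with $0 \le \mu < 1$ (depending on $f$, $\mathbf c$, $\mathbf r$, but not on the starting point) such that for every $\mathbf{z}^0 \in D$ the sequence defined by $\mathbf{z}^{k+1} = f(\mathbf{z}^k)$, $k = 0, 1, 2, \dots$, converges to $\mathbf{w}$ and satisfies $$ |\mathbf{z}^k - \mathbf{w}| < |\mathbf{r}|\,(1+\mu)\left(\frac{2\mu}{1+\mu^2}\right)^k, \qquad k = 0, 1, 2, \dots $$ -/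

import Mathlib

open Filter Topology

/-- The open polydisc in `ℂ^d` with centre `c` and polyradius `r`: the product of the open discs
`{x : ℂ | |x - c i| < r i}`. -/
def polydisc {d : ℕ} (c : Fin d → ℂ) (r : Fin d → ℝ) : Set (Fin d → ℂ) :=
  Set.pi Set.univ (fun i => Metric.ball (c i) (r i))

/-! An affine change of coordinates turns `D` into the unit polydisc, and compactness of the closure
of `f(D)` gives a map `F` into the polydisc of some radius `μ < 1`. Measure distance by the maximum
over coordinates of the pseudo-hyperbolic distances `‖discAut (-a) x‖`. Write `F = μ G` with `G` a
self-map: by Schwarz–Pick, `G` does not increase this distance, and scaling by `μ` shrinks it by the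
factor `2μ/(1+μ²) < 1`. So `F` is a strict contraction; the orbit of `0` is Cauchy and its limit is
a fixed point. All pseudo-hyperbolic distances are below `1`, so the bound does not depend on the
starting point; passing back to the Euclidean distance costs the factor `1 + μ`. -/

open Metric ComplexConjugate

/-- The automorphism of the open unit disc that sends `0` to `a`. -/
noncomputable def discAut (a x : ℂ) : ℂ := (x + a) / (1 + conj a * x)

/-- The automorphism of the unit polydisc that acts as `discAut (a i)` in coordinate `i`. -/
noncomputable def polydiscAut {d : ℕ} (a x : Fin d → ℂ) : Fin d → ℂ := fun i => discAut (a i) (x i)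

theorem one_add_mul_ne_zero_of_norm_lt_one {a x : ℂ} (ha : ‖a‖ < 1) (hx : ‖x‖ < 1) :
    1 + a * x ≠ 0 := by
  intro h
  have h1 : ‖a * x‖ = 1 := by
    rw [show a * x = -1 by linear_combination h]
    simp
  rw [norm_mul] at h1
  nlinarith [norm_nonneg a, norm_nonneg x]

theorem one_add_conj_mul_ne_zero {a x : ℂ} (ha : ‖a‖ < 1) (hx : ‖x‖ < 1) :
    1 + conj a * x ≠ 0 :=
  one_add_mul_ne_zero_of_norm_lt_one (by simpa using ha) hx

/-- The reason is `|1 + āx|² - |x + a|² = (1 - |a|²)(1 - |x|²)`. -/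
theorem norm_discAut_lt_one {a x : ℂ} (ha : ‖a‖ < 1) (hx : ‖x‖ < 1) : ‖discAut a x‖ < 1 := by
  have h0 := one_add_conj_mul_ne_zero ha hx
  rw [discAut, norm_div, div_lt_one (norm_pos_iff.2 h0)]
  refine lt_of_pow_lt_pow_left₀ 2 (norm_nonneg _) ?_
  have ha2 : ‖a‖ ^ 2 < 1 := by nlinarith [norm_nonneg a]
  have hx2 : ‖x‖ ^ 2 < 1 := by nlinarith [norm_nonneg x]
  rw [← Complex.normSq_eq_norm_sq, Complex.normSq_apply] at ha2 hx2 ⊢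
  rw [← Complex.normSq_eq_norm_sq, Complex.normSq_apply]
  simp only [Complex.add_re, Complex.add_im, Complex.mul_re, Complex.mul_im, Complex.conj_re,
    Complex.conj_im, Complex.one_re, Complex.one_im]
  nlinarith [mul_pos (sub_pos.2 ha2) (sub_pos.2 hx2)]

theorem discAut_zero_right (a : ℂ) : discAut a 0 = a := by simp [discAut]

theorem discAut_neg_self (a : ℂ) : discAut (-a) a = 0 := by simp [discAut]

theorem discAut_discAut_neg {a x : ℂ} (ha : ‖a‖ < 1) (hx : ‖x‖ < 1) :
    discAut a (discAut (-a) x) = x := by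
  have h1 : 1 - conj a * x ≠ 0 := by
    have := one_add_conj_mul_ne_zero (a := -a) (by simpa using ha) hx
    simpa [sub_eq_add_neg] using this
  have h2 := one_add_conj_mul_ne_zero ha (norm_discAut_lt_one (a := -a) (by simpa using ha) hx)
  have h3 : discAut (-a) x * (1 - conj a * x) = x - a := by
    rw [← div_mul_cancel₀ (x - a) h1, discAut, map_neg, neg_mul, ← sub_eq_add_neg,
      ← sub_eq_add_neg]
  rw [discAut, div_eq_iff h2]
  linear_combination h3

/-- The Euclidean distance in the disc is at most `1 + ‖a‖` times the pseudo-hyperbolic one. -/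
theorem norm_sub_le_norm_discAut_mul {a x : ℂ} (ha : ‖a‖ < 1) (hx : ‖x‖ < 1) :
    ‖x - a‖ ≤ ‖discAut (-a) x‖ * (1 + ‖a‖) := by
  have h1 : 1 + conj (-a) * x ≠ 0 := one_add_conj_mul_ne_zero (by simpa using ha) hx
  have h2 : x - a = discAut (-a) x * (1 + conj (-a) * x) := by
    rw [discAut, div_mul_cancel₀ _ h1, sub_eq_add_neg]
  have h3 : ‖1 + conj (-a) * x‖ ≤ 1 + ‖a‖ := by
    refine (norm_add_le _ _).trans ?_
    simp only [norm_one, norm_mul, RCLike.norm_conj, norm_neg]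
    nlinarith [norm_nonneg a]
  rw [h2, norm_mul]
  gcongr

/-- For `‖t‖ ≤ 1` the quotient `‖1 - t‖ / ‖1 - μ² t‖` is largest at `t = -1`. -/
theorem norm_one_sub_mul_le {μ : ℝ} (hμ0 : 0 < μ) (hμ1 : μ < 1) {t : ℂ} (ht : ‖t‖ ≤ 1) :
    (1 + μ ^ 2) * ‖1 - t‖ ≤ 2 * ‖1 - (μ : ℂ) ^ 2 * t‖ := by
  refine le_of_pow_le_pow_left₀ two_ne_zero (by positivity) ?_
  have ht2 : ‖t‖ ^ 2 ≤ 1 := by nlinarith [norm_nonneg t]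
  rw [mul_pow, mul_pow, ← Complex.normSq_eq_norm_sq, ← Complex.normSq_eq_norm_sq,
    Complex.normSq_apply, Complex.normSq_apply]
  rw [← Complex.normSq_eq_norm_sq, Complex.normSq_apply] at ht2
  rw [← Complex.ofReal_pow]
  simp only [Complex.sub_re, Complex.sub_im, Complex.re_ofReal_mul, Complex.im_ofReal_mul,
    Complex.one_re, Complex.one_im]
  obtain ⟨x, y⟩ := t
  simp only at ht2 ⊢
  have hs1 : μ ^ 2 < 1 := by nlinarith
  have hs0 : 0 < μ ^ 2 := by positivity
  generalize μ ^ 2 = s at *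
  have hx : -1 ≤ x := by nlinarith [mul_self_nonneg y]
  -- With `s = μ²`, right minus left is `(1-s)(1+3s)(1-|t|²) + 2(1-s)²(1+x)`.
  nlinarith [mul_nonneg (mul_nonneg (sub_nonneg.2 hs1.le) (sub_nonneg.2 hs1.le))
    (sub_nonneg.2 hx), mul_nonneg (mul_nonneg (sub_nonneg.2 hs1.le) (by linarith : 0 ≤ 1 + 3 * s))
    (sub_nonneg.2 ht2), mul_nonneg (sub_nonneg.2 hs1.le) (sub_nonneg.2 hx)]

/-- Shrinking the disc by `μ` contracts the pseudo-hyperbolic distance. -/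
theorem norm_discAut_mul_le {μ : ℝ} (hμ0 : 0 < μ) (hμ1 : μ < 1) {a x : ℂ} (ha : ‖a‖ < 1)
    (hx : ‖x‖ < 1) :
    ‖discAut (-(μ * a)) (μ * x)‖ ≤ 2 * μ / (1 + μ ^ 2) * ‖discAut (-a) x‖ := by
  have ht : ‖conj a * x‖ ≤ 1 := by
    rw [norm_mul, RCLike.norm_conj]
    nlinarith [norm_nonneg a, norm_nonneg x]
  have h1 : 1 - conj a * x ≠ 0 := by
    have := one_add_conj_mul_ne_zero (a := -a) (by simpa using ha) hx
    simpa [sub_eq_add_neg] using this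
  have key := norm_one_sub_mul_le hμ0 hμ1 ht
  have p1 := norm_pos_iff.2 h1
  have p2 : 0 < ‖1 - (μ : ℂ) ^ 2 * (conj a * x)‖ := by
    have : 0 < (1 + μ ^ 2) * ‖1 - conj a * x‖ := by positivity
    linarith
  have e1 : discAut (-(μ * a)) (μ * x) = μ * (x - a) / (1 - (μ : ℂ) ^ 2 * (conj a * x)) := by
    simp only [discAut, map_neg, map_mul, Complex.conj_ofReal]
    congr 1 <;> ring
  have e2 : discAut (-a) x = (x - a) / (1 - conj a * x) := by
    simp only [discAut, map_neg]
    congr 1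
    ring
  rw [e1, e2, norm_div, norm_div, norm_mul, Complex.norm_real, Real.norm_of_nonneg hμ0.le,
    div_mul_div_comm, div_le_div_iff₀ p2 (by positivity)]
  calc μ * ‖x - a‖ * ((1 + μ ^ 2) * ‖1 - conj a * x‖)
      ≤ μ * ‖x - a‖ * (2 * ‖1 - (μ : ℂ) ^ 2 * (conj a * x)‖) := by gcongr
    _ = _ := by ring

/-! ### Schwarz–Pick, contraction and fixed points on the unit polydisc -/

section Polydisc

variable {d : ℕ}

theorem norm_apply_lt_of_mem_ball {a : Fin d → ℂ} {R : ℝ} (ha : a ∈ ball (0 : Fin d → ℂ) R)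
    (i : Fin d) : ‖a i‖ < R :=
  (norm_le_pi_norm a i).trans_lt (mem_ball_zero_iff.1 ha)

theorem mem_ball_zero_iff_forall {a : Fin d → ℂ} {R : ℝ} (hR : 0 < R) :
    a ∈ ball (0 : Fin d → ℂ) R ↔ ∀ i, ‖a i‖ < R := by
  rw [mem_ball_zero_iff, pi_norm_lt_iff hR]

theorem neg_mem_ball_zero {a : Fin d → ℂ} {R : ℝ} (ha : a ∈ ball (0 : Fin d → ℂ) R) :
    -a ∈ ball (0 : Fin d → ℂ) R := by
  simpa using ha

theorem mapsTo_polydiscAut {a : Fin d → ℂ} (ha : a ∈ ball (0 : Fin d → ℂ) 1) :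
    Set.MapsTo (polydiscAut a) (ball 0 1) (ball 0 1) := fun _ hx =>
  (mem_ball_zero_iff_forall one_pos).2 fun i =>
    norm_discAut_lt_one (norm_apply_lt_of_mem_ball ha i) (norm_apply_lt_of_mem_ball hx i)

theorem differentiableOn_polydiscAut {a : Fin d → ℂ} (ha : a ∈ ball (0 : Fin d → ℂ) 1) :
    DifferentiableOn ℂ (polydiscAut a) (ball 0 1) := by
  refine differentiableOn_pi.2 fun i x hx => DifferentiableAt.differentiableWithinAt ?_
  have h := one_add_conj_mul_ne_zero (norm_apply_lt_of_mem_ball ha i)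
    (norm_apply_lt_of_mem_ball hx i)
  unfold polydiscAut discAut
  fun_prop (disch := exact h)

/-- The **Schwarz–Pick lemma** for the unit polydisc. -/
theorem norm_polydiscAut_neg_map_le {F : (Fin d → ℂ) → Fin d → ℂ}
    (hF : DifferentiableOn ℂ F (ball 0 1)) (hmaps : Set.MapsTo F (ball 0 1) (ball 0 1))
    {a x : Fin d → ℂ} (ha : a ∈ ball (0 : Fin d → ℂ) 1) (hx : x ∈ ball (0 : Fin d → ℂ) 1) :
    ‖polydiscAut (-F a) (F x)‖ ≤ ‖polydiscAut (-a) x‖ := by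
  have hFa := neg_mem_ball_zero (hmaps ha)
  have hm1 : Set.MapsTo (fun u => F (polydiscAut a u)) (ball 0 1) (ball 0 1) :=
    hmaps.comp (mapsTo_polydiscAut ha)
  have hm : Set.MapsTo (fun u => polydiscAut (-F a) (F (polydiscAut a u))) (ball 0 1) (ball 0 1) :=
    (mapsTo_polydiscAut hFa).comp hm1
  have hd : DifferentiableOn ℂ (fun u => polydiscAut (-F a) (F (polydiscAut a u))) (ball 0 1) :=
    (differentiableOn_polydiscAut hFa).comp
      (hF.comp (differentiableOn_polydiscAut ha) (mapsTo_polydiscAut ha)) hm1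
  have h0 : polydiscAut a 0 = a := funext fun i => discAut_zero_right (a i)
  have hu := mapsTo_polydiscAut (neg_mem_ball_zero ha) hx
  have hinv : polydiscAut a (polydiscAut (-a) x) = x := funext fun i =>
    discAut_discAut_neg (norm_apply_lt_of_mem_ball ha i) (norm_apply_lt_of_mem_ball hx i)
  -- Conjugation by automorphisms has made the map fix `0`, so the Schwarz lemma for the sup norm
  -- applies.
  have h := Complex.norm_le_norm_of_mapsTo_ball hd (hm.mono_right ball_subset_closedBall)
    (by simp only [h0]; exact funext fun i => discAut_neg_self (F a i)) (mem_ball_zero_iff.1 hu)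
  simpa only [hinv] using h

/-- A holomorphic self-map of the unit polydisc with values in the polydisc of radius `μ < 1`
contracts the pseudo-hyperbolic distance. -/
theorem norm_polydiscAut_neg_map_le_of_mapsTo_ball {F : (Fin d → ℂ) → Fin d → ℂ} {μ : ℝ}
    (hμ0 : 0 < μ) (hμ1 : μ < 1)
    (hF : DifferentiableOn ℂ F (ball 0 1)) (hmaps : Set.MapsTo F (ball 0 1) (ball 0 μ))
    {a x : Fin d → ℂ} (ha : a ∈ ball (0 : Fin d → ℂ) 1) (hx : x ∈ ball (0 : Fin d → ℂ) 1) :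
    ‖polydiscAut (-F a) (F x)‖ ≤ 2 * μ / (1 + μ ^ 2) * ‖polydiscAut (-a) x‖ := by
  have hμ : (μ : ℂ) ≠ 0 := by exact_mod_cast hμ0.ne'
  have hG : Set.MapsTo (fun y => (μ : ℂ)⁻¹ • F y) (ball 0 1) (ball 0 1) := fun y hy => by
    have := mem_ball_zero_iff.1 (hmaps hy)
    rw [mem_ball_zero_iff, norm_smul, norm_inv, Complex.norm_real, Real.norm_of_nonneg hμ0.le,
      inv_mul_lt_iff₀ hμ0, mul_one]
    exact this
  have hGd : DifferentiableOn ℂ (fun y => (μ : ℂ)⁻¹ • F y) (ball 0 1) :=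
    hF.fun_const_smul _
  have hSP := norm_polydiscAut_neg_map_le hGd hG ha hx
  refine (pi_norm_le_iff_of_nonneg (by positivity)).2 fun i => ?_
  have h := norm_discAut_mul_le hμ0 hμ1 (norm_apply_lt_of_mem_ball (hG ha) i)
    (norm_apply_lt_of_mem_ball (hG hx) i)
  simp only [Pi.smul_apply, smul_eq_mul, mul_inv_cancel_left₀ hμ] at h
  refine h.trans (mul_le_mul_of_nonneg_left (le_trans ?_ hSP) (by positivity))
  exact norm_le_pi_norm (polydiscAut (-((μ : ℂ)⁻¹ • F a)) ((μ : ℂ)⁻¹ • F x)) i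

theorem two_mul_div_one_add_sq_lt_one {μ : ℝ} (hμ1 : μ < 1) : 2 * μ / (1 + μ ^ 2) < 1 := by
  rw [div_lt_one (by positivity)]
  nlinarith [sq_pos_of_pos (sub_pos.2 hμ1)]

theorem norm_polydiscAut_neg_iterate_le {F : (Fin d → ℂ) → Fin d → ℂ} {μ : ℝ}
    (hμ0 : 0 < μ) (hμ1 : μ < 1)
    (hF : DifferentiableOn ℂ F (ball 0 1)) (hmaps : Set.MapsTo F (ball 0 1) (ball 0 μ))
    {a x : Fin d → ℂ} (ha : a ∈ ball (0 : Fin d → ℂ) 1) (hx : x ∈ ball (0 : Fin d → ℂ) 1) (k : ℕ) :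
    ‖polydiscAut (-F^[k] a) (F^[k] x)‖ ≤ (2 * μ / (1 + μ ^ 2)) ^ k * ‖polydiscAut (-a) x‖ := by
  have hit (k : ℕ) : Set.MapsTo F^[k] (ball 0 1) (ball 0 1) :=
    (hmaps.mono_right (ball_subset_ball hμ1.le)).iterate k
  induction k with
  | zero => simp
  | succ k ih =>
    rw [Function.iterate_succ_apply', Function.iterate_succ_apply', pow_succ', mul_assoc]
    exact (norm_polydiscAut_neg_map_le_of_mapsTo_ball hμ0 hμ1 hF hmaps (hit k ha) (hit k hx)).trans
      (mul_le_mul_of_nonneg_left ih (by positivity))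

/-- The base point `a` need not be fixed: `a = 0`, `x = F 0` compares consecutive iterates, which
yields existence. -/
theorem norm_iterate_apply_sub_lt {F : (Fin d → ℂ) → Fin d → ℂ} {μ : ℝ}
    (hμ0 : 0 < μ) (hμ1 : μ < 1)
    (hF : DifferentiableOn ℂ F (ball 0 1)) (hmaps : Set.MapsTo F (ball 0 1) (ball 0 μ))
    {a x : Fin d → ℂ} (ha : a ∈ ball (0 : Fin d → ℂ) 1) (hx : x ∈ ball (0 : Fin d → ℂ) 1) (k : ℕ)
    (i : Fin d) :
    ‖F^[k] x i - F^[k] a i‖ < (1 + ‖F^[k] a i‖) * (2 * μ / (1 + μ ^ 2)) ^ k := by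
  have hit : Set.MapsTo F^[k] (ball 0 1) (ball 0 1) :=
    (hmaps.mono_right (ball_subset_ball hμ1.le)).iterate k
  have hκ : 0 < (2 * μ / (1 + μ ^ 2)) ^ k := by positivity
  have h1 := norm_sub_le_norm_discAut_mul (norm_apply_lt_of_mem_ball (hit ha) i)
    (norm_apply_lt_of_mem_ball (hit hx) i)
  have h2 : ‖discAut (-F^[k] a i) (F^[k] x i)‖ < (2 * μ / (1 + μ ^ 2)) ^ k :=
    calc ‖discAut (-F^[k] a i) (F^[k] x i)‖
        ≤ ‖polydiscAut (-F^[k] a) (F^[k] x)‖ := norm_le_pi_norm (polydiscAut (-F^[k] a) _) i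
      _ ≤ (2 * μ / (1 + μ ^ 2)) ^ k * ‖polydiscAut (-a) x‖ :=
        norm_polydiscAut_neg_iterate_le hμ0 hμ1 hF hmaps ha hx k
      _ < (2 * μ / (1 + μ ^ 2)) ^ k * 1 := mul_lt_mul_of_pos_left
        (mem_ball_zero_iff.1 (mapsTo_polydiscAut (neg_mem_ball_zero ha) hx)) hκ
      _ = _ := mul_one _
  calc _ ≤ _ := h1
    _ < (2 * μ / (1 + μ ^ 2)) ^ k * (1 + ‖F^[k] a i‖) := by gcongr
    _ = _ := mul_comm _ _

/-- The quantitative estimate for the approach of the iterates to a fixed point. -/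
theorem norm_iterate_apply_sub_fixedPoint_lt {F : (Fin d → ℂ) → Fin d → ℂ} {μ : ℝ}
    (hμ0 : 0 < μ) (hμ1 : μ < 1)
    (hF : DifferentiableOn ℂ F (ball 0 1)) (hmaps : Set.MapsTo F (ball 0 1) (ball 0 μ))
    {w x : Fin d → ℂ} (hw : w ∈ ball (0 : Fin d → ℂ) 1) (hFw : F w = w)
    (hx : x ∈ ball (0 : Fin d → ℂ) 1) (k : ℕ) (i : Fin d) :
    ‖F^[k] x i - w i‖ < (1 + μ) * (2 * μ / (1 + μ ^ 2)) ^ k := by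
  have h := norm_iterate_apply_sub_lt hμ0 hμ1 hF hmaps hw hx k i
  rw [Function.iterate_fixed hFw] at h
  -- A fixed point is a value of `F`; this improves `1 + ‖w i‖` to `1 + μ`.
  have hwμ : ‖w i‖ < μ := norm_apply_lt_of_mem_ball (hFw ▸ hmaps hw) i
  exact h.trans_le (by gcongr)

theorem exists_fixedPoint_of_mapsTo_ball {F : (Fin d → ℂ) → Fin d → ℂ} {μ : ℝ}
    (hμ0 : 0 < μ) (hμ1 : μ < 1)
    (hF : DifferentiableOn ℂ F (ball 0 1)) (hmaps : Set.MapsTo F (ball 0 1) (ball 0 μ)) :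
    ∃ w ∈ ball (0 : Fin d → ℂ) 1, F w = w := by
  have hmaps1 := hmaps.mono_right (ball_subset_ball hμ1.le)
  have h0 : (0 : Fin d → ℂ) ∈ ball (0 : Fin d → ℂ) 1 := mem_ball_self one_pos
  have hcau : CauchySeq fun k => F^[k] 0 := by
    -- The constant `2` bounds `1 + ‖F^[k] 0 i‖`.
    refine cauchySeq_of_le_geometric _ 2 (two_mul_div_one_add_sq_lt_one hμ1) fun k => ?_
    rw [dist_eq_norm, norm_sub_rev, Function.iterate_succ_apply]
    refine (pi_norm_le_iff_of_nonneg (by positivity)).2 fun i => ?_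
    refine (norm_iterate_apply_sub_lt hμ0 hμ1 hF hmaps h0 (hmaps1 h0) k i).le.trans ?_
    have := norm_apply_lt_of_mem_ball (hmaps1.iterate k h0) i
    gcongr
    linarith
  obtain ⟨w, hw⟩ := cauchySeq_tendsto_of_complete hcau
  have hw' := hw.comp (tendsto_add_atTop_nat 1)
  -- The uniform radius `μ < 1` keeps the limit off the boundary, so `F` is continuous there.
  have hwμ : w ∈ closedBall (0 : Fin d → ℂ) μ :=
    isClosed_closedBall.mem_of_tendsto hw' <| Eventually.of_forall fun k => by
      simp only [Function.comp_apply, Function.iterate_succ_apply']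
      exact ball_subset_closedBall (hmaps (hmaps1.iterate k h0))
  have hw1 : w ∈ ball (0 : Fin d → ℂ) 1 := closedBall_subset_ball hμ1 hwμ
  refine ⟨w, hw1, ?_⟩
  have hc : ContinuousAt F w := (hF.differentiableAt (isOpen_ball.mem_nhds hw1)).continuousAt
  refine tendsto_nhds_unique (hc.tendsto.comp hw) ?_
  simpa only [Function.comp_def, Function.iterate_succ_apply'] using hw'

/-! ### Reduction of a general polydisc to the unit polydisc -/

/-- The affine map from the unit polydisc onto `polydisc c r`. -/
noncomputable def polydiscChart (c : Fin d → ℂ) (r : Fin d → ℝ) (x : Fin d → ℂ) : Fin d → ℂ :=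
  fun i => c i + r i * x i

/-- The inverse of `polydiscChart`. -/
noncomputable def polydiscChartInv (c : Fin d → ℂ) (r : Fin d → ℝ) (x : Fin d → ℂ) : Fin d → ℂ :=
  fun i => (x i - c i) / r i

theorem polydiscChart_inv {c : Fin d → ℂ} {r : Fin d → ℝ} (hr : ∀ i, 0 < r i) (x : Fin d → ℂ) :
    polydiscChart c r (polydiscChartInv c r x) = x := funext fun i => by
  have : (r i : ℂ) ≠ 0 := by exact_mod_cast (hr i).ne'
  simp only [polydiscChart, polydiscChartInv]
  field_simp
  ring

theorem polydiscChartInv_mem_ball_iff {c : Fin d → ℂ} {r : Fin d → ℝ} (hr : ∀ i, 0 < r i)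
    {x : Fin d → ℂ} : polydiscChartInv c r x ∈ ball (0 : Fin d → ℂ) 1 ↔ x ∈ polydisc c r := by
  simp only [mem_ball_zero_iff_forall one_pos, polydisc, Set.mem_univ_pi, mem_ball_iff_norm]
  refine forall_congr' fun i => ?_
  rw [polydiscChartInv, norm_div, Complex.norm_real, Real.norm_of_nonneg (hr i).le,
    div_lt_one (hr i)]

theorem polydiscChart_mem_polydisc {c : Fin d → ℂ} {r : Fin d → ℝ} (hr : ∀ i, 0 < r i)
    {x : Fin d → ℂ} (hx : x ∈ ball (0 : Fin d → ℂ) 1) : polydiscChart c r x ∈ polydisc c r := by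
  simp only [polydisc, Set.mem_univ_pi, mem_ball_iff_norm]
  intro i
  rw [polydiscChart, add_sub_cancel_left, norm_mul, Complex.norm_real,
    Real.norm_of_nonneg (hr i).le]
  exact mul_lt_of_lt_one_right (hr i) (norm_apply_lt_of_mem_ball hx i)

theorem continuous_polydiscChartInv (c : Fin d → ℂ) (r : Fin d → ℝ) :
    Continuous (polydiscChartInv c r) := by
  unfold polydiscChartInv
  fun_prop

theorem differentiable_polydiscChartInv (c : Fin d → ℂ) (r : Fin d → ℝ) :
    Differentiable ℂ (polydiscChartInv c r) := by
  unfold polydiscChartInv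
  simp only [div_eq_mul_inv]
  fun_prop

theorem differentiable_polydiscChart (c : Fin d → ℂ) (r : Fin d → ℝ) :
    Differentiable ℂ (polydiscChart c r) := by
  unfold polydiscChart
  fun_prop

/-- A set whose closure lies in the polydisc lies in a concentric smaller polydisc. -/
theorem exists_polydiscChartInv_mem_ball {c : Fin d → ℂ} {r : Fin d → ℝ} (hr : ∀ i, 0 < r i)
    {s : Set (Fin d → ℂ)} (hs : closure s ⊆ polydisc c r) :
    ∃ μ : ℝ, 0 < μ ∧ μ < 1 ∧ ∀ x ∈ s, polydiscChartInv c r x ∈ ball (0 : Fin d → ℂ) μ := by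
  have hbdd : Bornology.IsBounded (polydisc c r) :=
    Bornology.IsBounded.pi fun _ => isBounded_ball
  have hcomp : IsCompact (closure s) := isCompact_of_isClosed_isBounded isClosed_closure
    (hbdd.subset hs)
  rcases s.eq_empty_or_nonempty with rfl | hne
  · exact ⟨1 / 2, by norm_num, by norm_num, by simp⟩
  obtain ⟨y, hy, hmax⟩ := hcomp.exists_isMaxOn hne.closure
    (continuous_polydiscChartInv c r).norm.continuousOn
  have hy1 : ‖polydiscChartInv c r y‖ < 1 :=
    mem_ball_zero_iff.1 ((polydiscChartInv_mem_ball_iff hr).2 (hs hy))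
  -- Strictly above the maximum, hence `μ > 0`; with `μ = 0` the strict final bound would fail for
  -- `k ≥ 1`.
  obtain ⟨μ, h1, h2⟩ := exists_between hy1
  exact ⟨μ, (norm_nonneg _).trans_lt h1, h2, fun x hx =>
    mem_ball_zero_iff.2 ((hmax (subset_closure hx)).trans_lt h1)⟩

end Polydisc

/-- The norms on `Fin d → ℂ` and `Fin d → ℝ` are the `ℓ^∞` norms. -/
theorem mainTheorem2 (d : ℕ) (hd : 1 ≤ d) (c : Fin d → ℂ) (r : Fin d → ℝ) (hr : ∀ i, 0 < r i)
    (f : (Fin d → ℂ) → (Fin d → ℂ))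
    (hol : DifferentiableOn ℂ f (polydisc c r))
    (hcont : ContinuousOn f (closure (polydisc c r)))
    (hmap : closure (f '' polydisc c r) ⊆ polydisc c r) :
    (∃! w : Fin d → ℂ, w ∈ polydisc c r ∧ f w = w) ∧
      ∃ μ : ℝ, 0 ≤ μ ∧ μ < 1 ∧
        ∀ w ∈ polydisc c r, f w = w →
          ∀ z : ℕ → (Fin d → ℂ), z 0 ∈ polydisc c r → (∀ k, z (k + 1) = f (z k)) →
            Tendsto z atTop (𝓝 w) ∧
              ∀ k : ℕ, ‖z k - w‖ < ‖r‖ * (1 + μ) * (2 * μ / (1 + μ ^ 2)) ^ k := by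
  obtain ⟨μ, hμ0, hμ1, hμ⟩ := exists_polydiscChartInv_mem_ball hr hmap
  let F : (Fin d → ℂ) → Fin d → ℂ := fun x => polydiscChartInv c r (f (polydiscChart c r x))
  have hF : DifferentiableOn ℂ F (ball 0 1) :=
    (differentiable_polydiscChartInv c r).comp_differentiableOn
      (hol.comp (differentiable_polydiscChart c r).differentiableOn
        fun _ hx => polydiscChart_mem_polydisc hr hx)
  have hmaps : Set.MapsTo F (ball 0 1) (ball 0 μ) := fun x hx =>
    hμ _ (Set.mem_image_of_mem f (polydiscChart_mem_polydisc hr hx))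
  have hFinv (x : Fin d → ℂ) : F (polydiscChartInv c r x) = polydiscChartInv c r (f x) := by
    simp only [F, polydiscChart_inv hr]
  have hrpos : 0 < ‖r‖ := (norm_pos_iff.2 (hr ⟨0, hd⟩).ne').trans_le (norm_le_pi_norm r ⟨0, hd⟩)
  have hbound (w) (hw : w ∈ polydisc c r) (hfw : f w = w) (z : ℕ → Fin d → ℂ)
      (hz : z 0 ∈ polydisc c r) (hstep : ∀ k, z (k + 1) = f (z k)) (k : ℕ) :
      ‖z k - w‖ < ‖r‖ * (1 + μ) * (2 * μ / (1 + μ ^ 2)) ^ k := by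
    have hzk : polydiscChartInv c r (z k) = F^[k] (polydiscChartInv c r (z 0)) := by
      induction k with
      | zero => rfl
      | succ k ih => rw [hstep, Function.iterate_succ_apply', ← ih, hFinv]
    refine (pi_norm_lt_iff (by positivity)).2 fun i => ?_
    have h := norm_iterate_apply_sub_fixedPoint_lt hμ0 hμ1 hF hmaps
      ((polydiscChartInv_mem_ball_iff hr).2 hw) ((hFinv w).trans (by rw [hfw]))
      ((polydiscChartInv_mem_ball_iff hr).2 hz) k i
    rw [← hzk, polydiscChartInv, polydiscChartInv, ← sub_div, sub_sub_sub_cancel_right, norm_div,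
      Complex.norm_real, div_lt_iff₀ (norm_pos_iff.2 (hr i).ne')] at h
    refine h.trans_le ?_
    rw [mul_comm, mul_assoc ‖r‖]
    exact mul_le_mul_of_nonneg_right (norm_le_pi_norm r i) (by positivity)
  have hconv (w) (hw : w ∈ polydisc c r) (hfw : f w = w) (z : ℕ → Fin d → ℂ)
      (hz : z 0 ∈ polydisc c r) (hstep : ∀ k, z (k + 1) = f (z k)) : Tendsto z atTop (𝓝 w) := by
    rw [tendsto_iff_norm_sub_tendsto_zero]
    refine squeeze_zero (fun _ => norm_nonneg _)
      (fun k => (hbound w hw hfw z hz hstep k).le) ?_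
    simpa using (tendsto_pow_atTop_nhds_zero_of_lt_one (by positivity)
      (two_mul_div_one_add_sq_lt_one hμ1)).const_mul (‖r‖ * (1 + μ))
  refine ⟨?_, μ, hμ0.le, hμ1, fun w hw hfw z hz hstep =>
    ⟨hconv w hw hfw z hz hstep, hbound w hw hfw z hz hstep⟩⟩
  obtain ⟨v, hv, hFv⟩ := exists_fixedPoint_of_mapsTo_ball hμ0 hμ1 hF hmaps
  have hw := polydiscChart_mem_polydisc (c := c) hr hv
  have hfw : f (polydiscChart c r v) = polydiscChart c r v := by
    conv_rhs => rw [← hFv]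
    simp only [F, polydiscChart_inv hr]
  refine ⟨polydiscChart c r v, ⟨hw, hfw⟩, fun w' ⟨hw', hfw'⟩ => ?_⟩
  -- A second fixed point is a constant orbit, which must converge to the first.
  exact tendsto_nhds_unique tendsto_const_nhds
    (hconv _ hw hfw (fun _ => w') hw' fun _ => hfw'.symm)
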